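/- Let $G$ be a finite graph with no isolated vertices. In the achievement game of $G$ on the complete graph $K_N$, Alice and Bob alternately colour one previously uncoloured edge of $K_N$, Alice moving first and using blue, Bob using red, until all edges are coloured; the player who first completes a copy of $G$ in his or her own colour wins, and if neither player ever does so the game is a draw. The achievement number $a(G)$ is the smallest $N$ for which Alice has a winning strategy in this game. Let $K_{1,n-1}$ denote the star with $n-1$ edges. **Theorem.** For every integer $n\ge 3$, the achievement number $a(K_{1,n-1})$ is well defined (that is, Alice has a winning strategy on $K_N$ for some $N$), and $$2n-2-\sqrt{(4n-8)\,\ln(4n-4)}\;\le\; a(K_{1,n-1})\;\le\; 2n-2 .$$ -/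

import Mathlib

/-- A strategy on the board `X`: to every history `h` (the list of the elements claimed so far by
both players, in the order in which they were claimed) that leaves some element of the board
unclaimed, it assigns an unclaimed element. -/
def BoardStrategy (X : Type*) : Type _ :=
  (h : List X) → (∃ x, x ∉ h) → {x : X // x ∉ h}

/-- A complete play on the board `X`: the players alternately claim unclaimed elements, one per
move, until all elements of the board are claimed. -/
def IsCompletePlay {X : Type*} (h : List X) : Prop :=
  h.Nodup ∧ ∀ x, x ∈ h

/-- The elements claimed by Alice (the player who moves first) in the history `h`: those preceded
by an even number of moves. -/
def aliceClaims {X : Type*} (h : List X) : Set X :=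
  {x | ∃ u v : List X, h = u ++ x :: v ∧ Even u.length}

/-- The elements claimed by Bob (the player who moves second) in the history `h`: those preceded
by an odd number of moves. -/
def bobClaims {X : Type*} (h : List X) : Set X :=
  {x | ∃ u v : List X, h = u ++ x :: v ∧ Odd u.length}

/-- In the play `h`, every move of Alice is the one prescribed by the strategy `σ`. -/
def AliceFollows {X : Type*} (σ : BoardStrategy X) (h : List X) : Prop :=
  ∀ (u v : List X) (x : X), h = u ++ x :: v → Even u.length →
    ∀ hu : ∃ y, y ∉ u, x = (σ u hu : X)

/-- Alice wins the play `h` of the strong game with family of winning sets `F`: at some moment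
she has claimed all elements of a winning set, while Bob has not yet done so. -/
def AliceWinsPlay {X : Type*} (F : Set (Set X)) (h : List X) : Prop :=
  ∃ u : List X, u <+: h ∧ (∃ W ∈ F, W ⊆ aliceClaims u) ∧ ¬ ∃ W ∈ F, W ⊆ bobClaims u

/-- Alice has a winning strategy in the strong game on the finite board `X` with family of winning
sets `F`: a strategy such that she wins every complete play in which she follows it, whatever Bob
does. -/
def AliceHasWinningStrategy {X : Type*} [Finite X] (F : Set (Set X)) : Prop :=
  ∃ σ : BoardStrategy X, ∀ h : List X, IsCompletePlay h → AliceFollows σ h → AliceWinsPlay F h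

/-- The edge sets of the copies of `G` in the complete graph on `N` vertices, as sets of edges
of that complete graph. -/
def copiesInComplete {V : Type*} (G : SimpleGraph V) (N : ℕ) :
    Set (Set (⊤ : SimpleGraph (Fin N)).edgeSet) :=
  {W | ∃ f : V ↪ Fin N, W = {e | (e : Sym2 (Fin N)) ∈ (G.map f).edgeSet}}

/-- Alice has a winning strategy in the achievement game of `G` on `K_N`: the players alternately
colour an uncoloured edge of `K_N`, each in their own colour, Alice first, and the first player to
complete a copy of `G` in their own colour wins. -/
def AliceWinsAchievementGame {V : Type*} (G : SimpleGraph V) (N : ℕ) : Prop :=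
  AliceHasWinningStrategy (copiesInComplete G N)

/-- The achievement number of `G`: the least `N` for which Alice has a winning strategy in the
achievement game of `G` on `K_N` (meaningful when there is such an `N`). -/
noncomputable def achievementNumber {V : Type*} (G : SimpleGraph V) : ℕ :=
  sInf {N : ℕ | AliceWinsAchievementGame G N}

/-- The star `K_{1,m}`, with one centre and `m` leaves. -/
def starK (m : ℕ) : SimpleGraph (Fin 1 ⊕ Fin m) :=
  completeBipartiteGraph (Fin 1) (Fin m)

/-! Write m = n - 1. Upper bound: in any 2-colouring of K_{2m}, each vertex has 2m - 1 edges, so one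
colour has at least m of them. No draw is possible, and strategy stealing
(`aliceHasWinningStrategy_of_no_draw`) makes Alice the winner.

Lower bound: Bob only blocks. With `a` blue and `b` red edges at a vertex, give it weight (1 + l)^a
(1 - l)^b. Always taking the edge whose endpoints have the largest total weight, Bob keeps the sum
of the weights at most 2N (`exists_strategy_breakerPotential_le`). A blue star with m edges would
force one weight up to exp((2m - d)^2 / (2d)), where d = N - 1 and l = tanh((2m - d) / d). This
exceeds 2N when N is below the stated bound (`not_aliceHasWinningStrategy_of_discrepancy`). -/

/-! ### Bookkeeping of plays -/

section Claims

variable {X : Type*}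

theorem aliceClaims_nil : aliceClaims ([] : List X) = ∅ := by
  ext x; simp [aliceClaims]

theorem bobClaims_nil : bobClaims ([] : List X) = ∅ := by
  ext x; simp [bobClaims]

theorem concat_eq_append_cons_iff {h u v : List X} {x y : X} :
    h ++ [y] = u ++ x :: v ↔
      (h = u ∧ y = x ∧ v = []) ∨ ∃ w, v = w ++ [y] ∧ h = u ++ x :: w := by
  rcases List.eq_nil_or_concat v with rfl | ⟨w, z, rfl⟩
  · simp
  · have : u ++ x :: (w ++ [z]) = (u ++ x :: w) ++ [z] := by simp
    simp only [List.concat_eq_append, this]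
    constructor
    · intro e
      obtain ⟨h1, h2⟩ := List.append_inj' e rfl
      simp only [List.cons.injEq, and_true] at h2
      exact Or.inr ⟨w, by simp [h2], h1⟩
    · rintro (⟨_, _, h3⟩ | ⟨w', h1, rfl⟩)
      · simp at h3
      · obtain ⟨h2, h3⟩ := List.append_inj' h1 rfl
        subst h2
        simp only [List.cons.injEq, and_true] at h3
        simp [h3]

theorem mem_aliceClaims_concat {h : List X} {x y : X} :
    x ∈ aliceClaims (h ++ [y]) ↔ (x = y ∧ Even h.length) ∨ x ∈ aliceClaims h := by
  simp only [aliceClaims, Set.mem_ofPred_eq, concat_eq_append_cons_iff]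
  constructor
  · rintro ⟨u, v, ⟨rfl, rfl, rfl⟩ | ⟨w, rfl, rfl⟩, he⟩
    · exact Or.inl ⟨rfl, he⟩
    · exact Or.inr ⟨u, w, rfl, he⟩
  · rintro (⟨rfl, he⟩ | ⟨u, w, rfl, he⟩)
    · exact ⟨h, [], Or.inl ⟨rfl, rfl, rfl⟩, he⟩
    · exact ⟨u, w ++ [y], Or.inr ⟨w, rfl, rfl⟩, he⟩

theorem mem_bobClaims_concat {h : List X} {x y : X} :
    x ∈ bobClaims (h ++ [y]) ↔ (x = y ∧ Odd h.length) ∨ x ∈ bobClaims h := by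
  simp only [bobClaims, Set.mem_ofPred_eq, concat_eq_append_cons_iff]
  constructor
  · rintro ⟨u, v, ⟨rfl, rfl, rfl⟩ | ⟨w, rfl, rfl⟩, he⟩
    · exact Or.inl ⟨rfl, he⟩
    · exact Or.inr ⟨u, w, rfl, he⟩
  · rintro (⟨rfl, he⟩ | ⟨u, w, rfl, he⟩)
    · exact ⟨h, [], Or.inl ⟨rfl, rfl, rfl⟩, he⟩
    · exact ⟨u, w ++ [y], Or.inr ⟨w, rfl, rfl⟩, he⟩

theorem aliceClaims_concat_of_even {h : List X} (he : Even h.length) (y : X) :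
    aliceClaims (h ++ [y]) = insert y (aliceClaims h) := by
  ext x; simp [mem_aliceClaims_concat, he]

theorem aliceClaims_concat_of_odd {h : List X} (ho : Odd h.length) (y : X) :
    aliceClaims (h ++ [y]) = aliceClaims h := by
  ext x; simp [mem_aliceClaims_concat, Nat.not_even_iff_odd.2 ho]

theorem bobClaims_concat_of_even {h : List X} (he : Even h.length) (y : X) :
    bobClaims (h ++ [y]) = bobClaims h := by
  ext x; simp [mem_bobClaims_concat, Nat.not_odd_iff_even.2 he]

theorem bobClaims_concat_of_odd {h : List X} (ho : Odd h.length) (y : X) :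
    bobClaims (h ++ [y]) = insert y (bobClaims h) := by
  ext x; simp [mem_bobClaims_concat, ho]

theorem mem_claims_iff {h : List X} {x : X} :
    x ∈ aliceClaims h ∨ x ∈ bobClaims h ↔ x ∈ h := by
  constructor
  · rintro (⟨u, v, rfl, -⟩ | ⟨u, v, rfl, -⟩) <;> simp
  · intro hx
    obtain ⟨u, v, rfl⟩ := List.append_of_mem hx
    rcases Nat.even_or_odd u.length with he | ho
    · exact Or.inl ⟨u, v, rfl, he⟩
    · exact Or.inr ⟨u, v, rfl, ho⟩

theorem disjoint_claims {h : List X} (hn : h.Nodup) :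
    Disjoint (aliceClaims h) (bobClaims h) := by
  induction h using List.reverseRecOn with
  | nil => simp [aliceClaims_nil]
  | append_singleton h y ih =>
    rw [← List.concat_eq_append, List.nodup_concat] at hn
    have hA : y ∉ aliceClaims h := fun hy => hn.1 (mem_claims_iff.1 (Or.inl hy))
    have hB : y ∉ bobClaims h := fun hy => hn.1 (mem_claims_iff.1 (Or.inr hy))
    rcases Nat.even_or_odd h.length with he | ho
    · rw [aliceClaims_concat_of_even he, bobClaims_concat_of_even he, Set.disjoint_insert_left]
      exact ⟨hB, ih hn.2⟩
    · rw [aliceClaims_concat_of_odd ho, bobClaims_concat_of_odd ho, Set.disjoint_insert_right]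
      exact ⟨hA, ih hn.2⟩

/-- Every strategy for both players together generates a complete play. -/
theorem exists_isCompletePlay_of_strategy [Finite X] (ρ : BoardStrategy X) :
    ∃ h : List X, IsCompletePlay h ∧
      ∀ (u v : List X) (x : X), h = u ++ x :: v → ∀ hu : ∃ y, y ∉ u, x = (ρ u hu : X) := by
  classical
  have := Fintype.ofFinite X
  have key : ∀ k ≤ Fintype.card X, ∃ h : List X, h.Nodup ∧ h.length = k ∧
      ∀ (u v : List X) (x : X), h = u ++ x :: v → ∀ hu : ∃ y, y ∉ u, x = (ρ u hu : X) := by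
    intro k
    induction k with
    | zero => exact fun _ => ⟨[], by simp⟩
    | succ k ih =>
      intro hk
      obtain ⟨h, hn, hl, hρ⟩ := ih (by omega)
      have hfree : ∃ y, y ∉ h := by
        by_contra! hall
        have : Fintype.card X ≤ h.toFinset.card :=
          Finset.card_le_card fun x _ => List.mem_toFinset.2 (hall x)
        have := h.toFinset_card_le
        omega
      refine ⟨h ++ [(ρ h hfree : X)], ?_, by simp [hl], ?_⟩
      · rw [← List.concat_eq_append, List.nodup_concat]
        exact ⟨(ρ h hfree).2, hn⟩
      · intro u v x e hu
        rcases concat_eq_append_cons_iff.1 e with ⟨rfl, rfl, -⟩ | ⟨w, -, hw⟩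
        · rfl
        · exact hρ u w x hw hu
  obtain ⟨h, hn, hl, hρ⟩ := key _ le_rfl
  refine ⟨h, ⟨hn, fun x => ?_⟩, hρ⟩
  have : h.toFinset = Finset.univ := by
    rw [← Finset.card_eq_iff_eq_univ, List.toFinset_card_of_nodup hn, hl]
  exact List.mem_toFinset.1 (this ▸ Finset.mem_univ x)

theorem AliceWinsPlay.of_prefix {F : Set (Set X)} {u h : List X} (hw : AliceWinsPlay F u)
    (hp : u <+: h) : AliceWinsPlay F h := by
  obtain ⟨w, hwu, hF⟩ := hw
  exact ⟨w, hwu.trans hp, hF⟩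

end Claims

/-! ### Determinacy and strategy stealing -/

section StrategyStealing

variable {X : Type*}

/-- Some winning set is contained in `A`. -/
def HasWinningSet (F : Set (Set X)) (A : Set X) : Prop :=
  ∃ W ∈ F, W ⊆ A

theorem HasWinningSet.mono {F : Set (Set X)} {A A' : Set X} (h : HasWinningSet F A)
    (hA : A ⊆ A') : HasWinningSet F A' :=
  h.imp fun _ hW => ⟨hW.1, hW.2.trans hA⟩

/-- The player owning `A` can force being the first to complete a winning set against the opponent
owning `B` within `k` further moves; the Boolean tells whether that player is to move. -/
def CanWin (F : Set (Set X)) : ℕ → Bool → Set X → Set X → Prop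
  | 0, _, A, _ => HasWinningSet F A
  | k + 1, true, A, B =>
    HasWinningSet F A ∨ ∃ x, x ∉ A ∧ x ∉ B ∧ CanWin F k false (insert x A) B
  | k + 1, false, A, B =>
    HasWinningSet F A ∨ ∀ y, y ∉ A → y ∉ B →
      ¬ HasWinningSet F (insert y B) ∧ CanWin F k true A (insert y B)

theorem HasWinningSet.canWin {F : Set (Set X)} {A : Set X} (h : HasWinningSet F A) (k : ℕ)
    (b : Bool) (B : Set X) : CanWin F k b A B := by
  cases k with
  | zero => exact h
  | succ k => cases b <;> exact Or.inl h

theorem ncard_free_of_insert [Finite X] {C : Set X} {x : X} {k : ℕ} (hx : x ∉ C)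
    (hk : Cᶜ.ncard = k + 1) : (insert x C)ᶜ.ncard = k := by
  have : (insert x C)ᶜ = Cᶜ \ {x} := by
    ext y; simp [not_or, and_comm]
  rw [this, Set.ncard_sdiff_singleton_of_mem hx, hk, Nat.add_sub_cancel]

theorem exists_free_of_ncard {C : Set X} {k : ℕ} (hk : Cᶜ.ncard = k + 1) : ∃ x, x ∉ C :=
  Set.nonempty_of_ncard_ne_zero (s := Cᶜ) (by omega)

/-- Owning an additional element does no harm. -/
theorem CanWin.insert_left [Finite X] {F : Set (Set X)} {k : ℕ} {b : Bool} {A B : Set X} {x : X}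
    (h : CanWin F (k + 1) b A B) (hk : (A ∪ B)ᶜ.ncard = k + 1) (hxA : x ∉ A) (hxB : x ∉ B) :
    CanWin F k b (insert x A) B := by
  induction k generalizing b A B x with
  | zero =>
    have hk' := ncard_free_of_insert (x := x) (by simp [hxA, hxB]) hk
    rw [Set.ncard_eq_zero] at hk'
    have hall : ∀ z, z = x ∨ z ∈ A ∨ z ∈ B := fun z => by
      have : z ∉ (insert x (A ∪ B))ᶜ := by simp [hk']
      simp only [Set.mem_compl_iff, Set.mem_insert_iff, Set.mem_union, not_not] at this
      exact this
    cases b with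
    | true =>
      rcases h with h | ⟨z, hzA, hzB, hz⟩
      · exact h.mono (Set.subset_insert _ _)
      · obtain rfl : z = x := by have := hall z; tauto
        exact hz
    | false =>
      rcases h with h | h
      · exact h.mono (Set.subset_insert _ _)
      · exact (h x hxA hxB).2.mono (Set.subset_insert _ _)
  | succ k ih =>
    have hk' := ncard_free_of_insert (x := x) (by simp [hxA, hxB]) hk
    cases b with
    | true =>
      rcases h with h | ⟨z, hzA, hzB, hz⟩
      · exact Or.inl (h.mono (Set.subset_insert _ _))
      -- If the prescribed move is the element already owned, any free `y` is claimed instead and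
      -- takes over the role of the spare element.
      · by_cases hzx : z = x
        · subst hzx
          obtain ⟨y, hy⟩ := exists_free_of_ncard hk'
          simp only [Set.mem_insert_iff, Set.mem_union, not_or] at hy
          refine Or.inr ⟨y, by simp [hy], hy.2.2, ih hz ?_ (by simp [hy]) hy.2.2⟩
          rwa [Set.insert_union]
        · refine Or.inr ⟨z, by simp [hzx, hzA], hzB, ?_⟩
          rw [Set.insert_comm]
          refine ih hz ?_ (by simp [hxA, Ne.symm hzx]) hxB
          rw [Set.insert_union]
          exact ncard_free_of_insert (by simp [hzA, hzB]) hk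
    | false =>
      rcases h with h | h
      · exact Or.inl (h.mono (Set.subset_insert _ _))
      · refine Or.inr fun y hyA hyB => ?_
        simp only [Set.mem_insert_iff, not_or] at hyA
        obtain ⟨h1, h2⟩ := h y hyA.2 hyB
        refine ⟨h1, ih h2 ?_ hxA (by simp [hxB, Ne.symm hyA.1])⟩
        rw [Set.union_insert]
        exact ncard_free_of_insert (by simp [hyA.2, hyB]) hk

/-- Having the move does no harm. -/
theorem CanWin.move [Finite X] {F : Set (Set X)} {k : ℕ} {A B : Set X}
    (h : CanWin F k false A B) (hk : (A ∪ B)ᶜ.ncard = k) : CanWin F k true A B := by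
  cases k with
  | zero => exact h
  | succ k =>
    obtain ⟨x, hx⟩ := exists_free_of_ncard hk
    simp only [Set.mem_union, not_or] at hx
    exact Or.inr ⟨x, hx.1, hx.2, h.insert_left hk hx.1 hx.2⟩

/-- Determinacy of a strong game in which no draw is possible. -/
theorem canWin_or_canWin [Finite X] {F : Set (Set X)}
    (hF : ∀ A B : Set X, A ∪ B = Set.univ → HasWinningSet F A ∨ HasWinningSet F B)
    {k : ℕ} {A B : Set X} (hk : (A ∪ B)ᶜ.ncard = k) :
    CanWin F k true A B ∨ CanWin F k false B A := by
  induction k generalizing A B with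
  | zero =>
    rw [Set.ncard_eq_zero, Set.compl_empty_iff] at hk
    exact hF A B hk
  | succ k ih =>
    by_contra! hcon
    refine hcon.2 (Or.inr fun x hxB hxA => ?_)
    -- No move `x` wins for the owner of `A`; by induction the owner of `B` then wins after each
    -- such move.
    have hno : ¬ CanWin F k false (insert x A) B := fun h =>
      hcon.1 (Or.inr ⟨x, hxA, hxB, h⟩)
    refine ⟨fun h => hno (h.canWin _ _ _), ?_⟩
    refine (ih (A := B) (B := insert x A) ?_).resolve_right hno
    rw [Set.union_insert, Set.union_comm]
    exact ncard_free_of_insert (by simp [hxA, hxB]) hk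

/-- Passes from the recursive notion to strategies on histories: Alice always picks a move that
preserves `CanWin`. Since `CanWin` does not record whether Bob has already won, the invariant
carries that condition separately, and `h0` starts it. -/
theorem CanWin.aliceHasWinningStrategy [Finite X] {F : Set (Set X)} (h0 : ¬ HasWinningSet F ∅)
    (h : CanWin F (Nat.card X) true ∅ ∅) : AliceHasWinningStrategy F := by
  classical
  let good (u : List X) (x : X) : Prop :=
    x ∉ u ∧ CanWin F ((aliceClaims u ∪ bobClaims u)ᶜ.ncard - 1) false
      (insert x (aliceClaims u)) (bobClaims u)
  let σ : BoardStrategy X := fun u hu =>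
    if hg : ∃ x, good u x then ⟨hg.choose, hg.choose_spec.1⟩ else ⟨hu.choose, hu.choose_spec⟩
  have hσ : ∀ u hu, (∃ x, good u x) → good u (σ u hu) := by
    intro u hu hg
    simp only [σ, dif_pos hg]
    exact hg.choose_spec
  refine ⟨σ, fun p hp hfol => ?_⟩
  have inv : ∀ u : List X, u <+: p → AliceWinsPlay F u ∨ (¬ HasWinningSet F (bobClaims u) ∧
      CanWin F (aliceClaims u ∪ bobClaims u)ᶜ.ncard (decide (Even u.length))
        (aliceClaims u) (bobClaims u)) := by
    intro u
    induction u using List.reverseRecOn with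
    | nil =>
      intro _
      refine Or.inr ⟨by rwa [bobClaims_nil], ?_⟩
      simpa [aliceClaims_nil, bobClaims_nil, Set.ncard_univ] using h
    | append_singleton u y ih =>
      intro hup
      have hu' : u <+: u ++ [y] := List.prefix_append _ _
      have hyu : y ∉ u := by
        have := hp.1.sublist hup.sublist
        rw [← List.concat_eq_append, List.nodup_concat] at this
        exact this.1
      have hyA : y ∉ aliceClaims u := fun hy => hyu (mem_claims_iff.1 (Or.inl hy))
      have hyB : y ∉ bobClaims u := fun hy => hyu (mem_claims_iff.1 (Or.inr hy))
      rcases ih (hu'.trans hup) with hw | ⟨hB, hC⟩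
      · exact Or.inl (hw.of_prefix hu')
      by_cases hA : HasWinningSet F (aliceClaims u)
      · exact Or.inl ⟨u, hu', hA, hB⟩
      obtain ⟨k, hk⟩ : ∃ k, (aliceClaims u ∪ bobClaims u)ᶜ.ncard = k + 1 := by
        refine Nat.exists_eq_add_one.2 ((Set.ncard_pos).2 ⟨y, ?_⟩)
        simp [hyA, hyB]
      have hk' := ncard_free_of_insert (x := y) (by simp [hyA, hyB]) hk
      right
      rcases Nat.even_or_odd u.length with he | ho
      · rw [hk, decide_eq_true he] at hC
        rcases hC with hC | ⟨x, hxA, hxB, hx⟩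
        · exact absurd hC hA
        have hg : ∃ x, good u x :=
          ⟨x, fun hxu => (mem_claims_iff.2 hxu).elim hxA hxB, by rwa [hk]⟩
        obtain ⟨v, hv⟩ := hup
        have hy : y = σ u ⟨y, hyu⟩ := hfol u v y (by simp [← hv]) he ⟨y, hyu⟩
        have hgy := (hσ u ⟨y, hyu⟩ hg).2
        rw [← hy, hk] at hgy
        have : ¬ Even (u ++ [y]).length := by simpa [Nat.even_add_one] using he
        rw [aliceClaims_concat_of_even he, bobClaims_concat_of_even he, Set.insert_union, hk',
          decide_eq_false this]
        exact ⟨hB, hgy⟩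
      · rw [hk, decide_eq_false (Nat.not_even_iff_odd.2 ho)] at hC
        rcases hC with hC | hC
        · exact absurd hC hA
        have : Even (u ++ [y]).length := by simpa [Nat.even_add_one] using ho
        rw [aliceClaims_concat_of_odd ho, bobClaims_concat_of_odd ho, Set.union_insert, hk',
          decide_eq_true this]
        exact hC y hyA hyB
  rcases inv p List.prefix_rfl with hw | ⟨hB, hC⟩
  · exact hw
  · have : (aliceClaims p ∪ bobClaims p)ᶜ.ncard = 0 := by
      rw [Set.ncard_eq_zero, Set.compl_empty_iff, Set.eq_univ_iff_forall]
      exact fun x => mem_claims_iff.2 (hp.2 x)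
    rw [this] at hC
    exact ⟨p, List.prefix_rfl, hC, hB⟩

/-- Strategy stealing: the first player wins every strong game in which no draw is possible. -/
theorem aliceHasWinningStrategy_of_no_draw [Finite X] {F : Set (Set X)}
    (h0 : ¬ HasWinningSet F ∅)
    (hF : ∀ A B : Set X, A ∪ B = Set.univ → HasWinningSet F A ∨ HasWinningSet F B) :
    AliceHasWinningStrategy F := by
  have hk : ((∅ : Set X) ∪ ∅)ᶜ.ncard = Nat.card X := by simp [Set.ncard_univ]
  exact CanWin.aliceHasWinningStrategy h0 ((canWin_or_canWin hF hk).elim id fun h => h.move hk)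

end StrategyStealing

/-! ### Bob's blocking strategy by a potential function -/

section DegreePotential

variable {X V : Type*}

/-- The weight of the set `I`, of which `A` has been claimed by Maker and `B` by Breaker. -/
noncomputable def breakerWeight (l : ℝ) (I A B : Set X) : ℝ :=
  (1 + l) ^ (A ∩ I).ncard * (1 - l) ^ (B ∩ I).ncard

theorem breakerWeight_nonneg {l : ℝ} (h0 : 0 ≤ l) (h1 : l ≤ 1) (I A B : Set X) :
    0 ≤ breakerWeight l I A B :=
  mul_nonneg (pow_nonneg (by linarith) _) (pow_nonneg (by linarith) _)

open Classical in
/-- The total weight of the sets containing `x`. -/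
noncomputable def breakerDanger [Fintype V] (l : ℝ) (I : V → Set X) (A B : Set X) (x : X) : ℝ :=
  ∑ v, if x ∈ I v then breakerWeight l (I v) A B else 0

/-- The total weight of all sets. -/
noncomputable def breakerPotential [Fintype V] (l : ℝ) (I : V → Set X) (A B : Set X) : ℝ :=
  ∑ v, breakerWeight l (I v) A B

theorem breakerPotential_insert_left [Finite X] [Fintype V] (l : ℝ) (I : V → Set X) {A : Set X}
    (B : Set X) {x : X} (hx : x ∉ A) :
    breakerPotential l I (insert x A) B =
      breakerPotential l I A B + l * breakerDanger l I A B x := by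
  classical
  simp only [breakerPotential, breakerDanger, Finset.mul_sum, ← Finset.sum_add_distrib]
  refine Finset.sum_congr rfl fun v _ => ?_
  by_cases hv : x ∈ I v
  · rw [if_pos hv, breakerWeight, breakerWeight, Set.insert_inter_of_mem hv,
      Set.ncard_insert_of_notMem (fun h => hx h.1)]
    ring
  · rw [if_neg hv, breakerWeight, breakerWeight, Set.insert_inter_of_notMem hv]
    ring

theorem breakerPotential_insert_right [Finite X] [Fintype V] (l : ℝ) (I : V → Set X) (A : Set X)
    {B : Set X} {x : X} (hx : x ∉ B) :
    breakerPotential l I A (insert x B) =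
      breakerPotential l I A B - l * breakerDanger l I A B x := by
  classical
  simp only [breakerPotential, breakerDanger, Finset.mul_sum, ← Finset.sum_sub_distrib]
  refine Finset.sum_congr rfl fun v _ => ?_
  by_cases hv : x ∈ I v
  · rw [if_pos hv, breakerWeight, breakerWeight, Set.insert_inter_of_mem hv,
      Set.ncard_insert_of_notMem (fun h => hx h.1)]
    ring
  · rw [if_neg hv, breakerWeight, breakerWeight, Set.insert_inter_of_notMem hv]
    ring

theorem breakerDanger_insert_right_le [Finite X] [Fintype V] {l : ℝ} (h0 : 0 ≤ l) (h1 : l ≤ 1)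
    (I : V → Set X) (A B : Set X) (x y : X) :
    breakerDanger l I A (insert y B) x ≤ breakerDanger l I A B x := by
  classical
  refine Finset.sum_le_sum fun v _ => ?_
  split_ifs
  · refine mul_le_mul_of_nonneg_left ?_ (pow_nonneg (by linarith) _)
    exact pow_le_pow_of_le_one (by linarith) (by linarith)
      (Set.ncard_le_ncard (Set.inter_subset_inter_left _ (Set.subset_insert _ _)))
  · exact le_rfl

theorem breakerDanger_empty_le [Fintype V] (l : ℝ) (I : V → Set X) (x : X) :
    breakerDanger l I ∅ ∅ x ≤ Fintype.card V := by
  classical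
  calc breakerDanger l I ∅ ∅ x ≤ ∑ _v : V, (1 : ℝ) := by
        refine Finset.sum_le_sum fun v _ => ?_
        simp only [breakerWeight, Set.empty_inter, Set.ncard_empty, pow_zero, mul_one]
        split_ifs <;> norm_num
    _ = Fintype.card V := by simp

/-- Bob can keep the potential below twice the number of sets. -/
theorem exists_strategy_breakerPotential_le [Finite X] [Fintype V] {l : ℝ} (h0 : 0 ≤ l)
    (h1 : l ≤ 1) (I : V → Set X) :
    ∃ τ : BoardStrategy X, ∀ h : List X, h.Nodup →
      (∀ (u v : List X) (x : X), h = u ++ x :: v → Odd u.length →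
        ∀ hu : ∃ y, y ∉ u, x = (τ u hu : X)) →
      breakerPotential l I (aliceClaims h) (bobClaims h) ≤ 2 * Fintype.card V := by
  -- Bob's rule: claim a free element of maximal danger.
  have hmax : ∀ (h : List X) (_ : ∃ x, x ∉ h), ∃ y : {x : X // x ∉ h}, ∀ x : {x : X // x ∉ h},
      breakerDanger l I (aliceClaims h) (bobClaims h) x ≤
        breakerDanger l I (aliceClaims h) (bobClaims h) y := fun h hh =>
    have : Nonempty {x : X // x ∉ h} := hh.elim fun x hx => ⟨⟨x, hx⟩⟩
    Finite.exists_max fun x : {x : X // x ∉ h} =>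
      breakerDanger l I (aliceClaims h) (bobClaims h) x
  choose τ hτ using hmax
  -- The second conjunct anticipates Alice's next move. Bob's gain `l * danger y` covers her next
  -- increase, because his move raises no danger and `y` was maximal. Her first move costs at most
  -- `l * card V`, hence the factor 2.
  have key : ∀ h : List X, h.Nodup →
      (∀ (u v : List X) (x : X), h = u ++ x :: v → Odd u.length →
        ∀ hu : ∃ y, y ∉ u, x = (τ u hu : X)) →
      breakerPotential l I (aliceClaims h) (bobClaims h) ≤ 2 * Fintype.card V ∧
        (Even h.length → ∀ x ∉ h, breakerPotential l I (aliceClaims h) (bobClaims h) +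
          l * breakerDanger l I (aliceClaims h) (bobClaims h) x ≤ 2 * Fintype.card V) := by
    intro h
    induction h using List.reverseRecOn with
    | nil =>
      intro _ _
      have hV : (0 : ℝ) ≤ Fintype.card V := Nat.cast_nonneg _
      have hpot : breakerPotential l I ∅ ∅ = Fintype.card V := by
        simp [breakerPotential, breakerWeight]
      rw [aliceClaims_nil, bobClaims_nil, hpot]
      refine ⟨by linarith, fun _ x _ => ?_⟩
      have := mul_le_mul_of_nonneg_left (breakerDanger_empty_le l I x) h0
      have := mul_le_mul_of_nonneg_right h1 hV
      linarith
    | append_singleton h y ih =>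
      intro hn hfol
      rw [← List.concat_eq_append, List.nodup_concat] at hn
      obtain ⟨hy, hn⟩ := hn
      have hyA : y ∉ aliceClaims h := fun h' => hy (mem_claims_iff.1 (Or.inl h'))
      have hyB : y ∉ bobClaims h := fun h' => hy (mem_claims_iff.1 (Or.inr h'))
      obtain ⟨ih1, ih2⟩ := ih hn fun u v x e => hfol u (v ++ [y]) x (by simp [e])
      rcases Nat.even_or_odd h.length with he | ho
      · rw [aliceClaims_concat_of_even he, bobClaims_concat_of_even he,
          breakerPotential_insert_left l I _ hyA]
        refine ⟨ih2 he y hy, fun he' => ?_⟩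
        simp only [List.length_append, List.length_singleton, Nat.even_add_one] at he'
        exact absurd he he'
      · have hyτ : y = τ h ⟨y, hy⟩ := hfol h [] y rfl ho ⟨y, hy⟩
        have hym := hτ h ⟨y, hy⟩
        rw [← hyτ] at hym
        rw [aliceClaims_concat_of_odd ho, bobClaims_concat_of_odd ho,
          breakerPotential_insert_right l I _ hyB]
        have hyd : 0 ≤ breakerDanger l I (aliceClaims h) (bobClaims h) y := by
          classical
          refine Finset.sum_nonneg fun v _ => ?_
          split_ifs
          · exact breakerWeight_nonneg h0 h1 _ _ _
          · exact le_rfl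
        refine ⟨by linarith [mul_nonneg h0 hyd], fun _ x hx => ?_⟩
        have hxh : x ∉ h := fun h' => hx (by simp [h'])
        have e1 := mul_le_mul_of_nonneg_left (breakerDanger_insert_right_le h0 h1 I
          (aliceClaims h) (bobClaims h) x y) h0
        have e2 := mul_le_mul_of_nonneg_left (hym ⟨x, hxh⟩) h0
        dsimp only at e2
        linarith
  exact ⟨τ, fun h hn hf => (key h hn hf).1⟩

theorem one_add_tanh (t : ℝ) : 1 + Real.tanh t = Real.exp t / Real.cosh t := by
  have := (Real.cosh_pos t).ne'
  rw [Real.tanh_eq_sinh_div_cosh, ← Real.cosh_add_sinh]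
  field_simp

theorem one_sub_tanh (t : ℝ) : 1 - Real.tanh t = Real.exp (-t) / Real.cosh t := by
  have := (Real.cosh_pos t).ne'
  rw [Real.tanh_eq_sinh_div_cosh, ← Real.cosh_sub_sinh]
  field_simp

/-- Since 1 ± tanh t = exp(±t) / cosh t, the product is exp(t(a - b)) / cosh(t)^(a + b). Now use a -
b = 2a - (a + b) and cosh t ≤ exp(t^2 / 2). -/
theorem exp_le_pow_tanh {t : ℝ} (ht : 0 ≤ t) {a b d m : ℕ} (hm : m ≤ a) (hd : a + b ≤ d) :
    Real.exp (t * (2 * m - d) - d * (t ^ 2 / 2)) ≤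
      (1 + Real.tanh t) ^ a * (1 - Real.tanh t) ^ b := by
  have hc := Real.cosh_pos t
  have e : (1 + Real.tanh t) ^ a * (1 - Real.tanh t) ^ b =
      Real.exp (t * (a - b)) / Real.cosh t ^ (a + b) := by
    rw [one_add_tanh, one_sub_tanh, div_pow, div_pow, ← Real.exp_nat_mul, ← Real.exp_nat_mul,
      div_mul_div_comm, ← Real.exp_add, ← pow_add]
    congr 2
    ring
  have hcosh : Real.cosh t ^ (a + b) ≤ Real.exp (d * (t ^ 2 / 2)) := by
    rw [Real.exp_nat_mul]
    exact (pow_le_pow_left₀ hc.le (Real.cosh_le_exp_half_sq t) _).trans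
      (pow_le_pow_right₀ (Real.one_le_exp (by positivity)) hd)
  have hmd : (2 * m - d : ℝ) ≤ a - b := by
    have h1 : (m : ℝ) ≤ a := by exact_mod_cast hm
    have h2 : (a + b : ℝ) ≤ d := by exact_mod_cast hd
    linarith
  rw [e, Real.exp_sub]
  exact div_le_div₀ (Real.exp_pos _).le
    (Real.exp_le_exp.2 (mul_le_mul_of_nonneg_left hmd ht)) (pow_pos hc _) hcosh

/-- If every winning set meets one of few sets of size at most `d` in at least `m` elements, with
`m` sufficiently above `d / 2`, then Bob can prevent Alice from completing a winning set. -/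
theorem not_aliceHasWinningStrategy_of_discrepancy [Finite X] [Fintype V] {F : Set (Set X)}
    (I : V → Set X) {d m : ℕ} (hd : 0 < d) (hdm : d ≤ 2 * m) (hI : ∀ v, (I v).ncard ≤ d)
    (hF : ∀ W ∈ F, ∃ v, m ≤ (W ∩ I v).ncard)
    (hV : 2 * (Fintype.card V : ℝ) < Real.exp ((2 * m - d) ^ 2 / (2 * d))) :
    ¬ AliceHasWinningStrategy F := by
  classical
  rintro ⟨σ, hσ⟩
  have hd' : (0 : ℝ) < d := by exact_mod_cast hd
  -- This value maximizes t(2m - d) - d t^2 / 2.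
  set t : ℝ := (2 * m - d) / d with ht
  have ht0 : 0 ≤ t := by
    have : (d : ℝ) ≤ 2 * m := by exact_mod_cast hdm
    exact div_nonneg (by linarith) hd'.le
  have hl0 : 0 ≤ Real.tanh t := by
    rw [Real.tanh_eq_sinh_div_cosh]
    exact div_nonneg (Real.sinh_nonneg_iff.2 ht0) (Real.cosh_pos t).le
  have hl1 : Real.tanh t ≤ 1 := (Real.tanh_lt_one t).le
  obtain ⟨τ, hτ⟩ := exists_strategy_breakerPotential_le hl0 hl1 I
  -- The supposed winning strategy is played against Bob's rule.
  obtain ⟨h, hh, hρ⟩ := exists_isCompletePlay_of_strategy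
    (fun u hu => if Even u.length then σ u hu else τ u hu : BoardStrategy X)
  have hA : AliceFollows σ h := fun u v x e he hu => by
    rw [hρ u v x e hu, if_pos he]
  obtain ⟨u, ⟨s, hs⟩, ⟨W, hWF, hW⟩, -⟩ := hσ h hh hA
  have hun : u.Nodup := hh.1.sublist (hs ▸ List.sublist_append_left u s)
  have hpot := hτ u hun fun u' v' x e ho hu => by
    rw [hρ u' (v' ++ s) x (by simp [← hs, e]) hu, if_neg (Nat.not_even_iff_odd.2 ho)]
  obtain ⟨v, hv⟩ := hF W hWF
  have ha : m ≤ (aliceClaims u ∩ I v).ncard :=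
    hv.trans (Set.ncard_le_ncard (Set.inter_subset_inter_left _ hW))
  have hab : (aliceClaims u ∩ I v).ncard + (bobClaims u ∩ I v).ncard ≤ d := by
    rw [← Set.ncard_union_eq
      ((disjoint_claims hun).mono Set.inter_subset_left Set.inter_subset_left)]
    exact (Set.ncard_le_ncard (Set.union_subset Set.inter_subset_right
      Set.inter_subset_right)).trans (hI v)
  have hw := exp_le_pow_tanh ht0 ha hab
  have hle : breakerWeight (Real.tanh t) (I v) (aliceClaims u) (bobClaims u) ≤
      breakerPotential (Real.tanh t) I (aliceClaims u) (bobClaims u) :=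
    Finset.single_le_sum (f := fun v => breakerWeight (Real.tanh t) (I v) (aliceClaims u)
      (bobClaims u)) (fun v _ => breakerWeight_nonneg hl0 hl1 _ _ _) (Finset.mem_univ v)
  have hexp : t * (2 * m - d) - d * (t ^ 2 / 2) = (2 * m - d) ^ 2 / (2 * d) := by
    rw [ht]; field_simp; ring
  rw [hexp] at hw
  exact absurd (hw.trans (hle.trans hpot)) (not_le.2 hV)

end DegreePotential

/-! ### Stars in complete graphs -/

section Stars

theorem mem_map_starK_edgeSet {m N : ℕ} (f : Fin 1 ⊕ Fin m ↪ Fin N) (e : Sym2 (Fin N)) :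
    e ∈ ((starK m).map f).edgeSet ↔ ∃ i, e = s(f (Sum.inl 0), f (Sum.inr i)) := by
  induction e using Sym2.ind with
  | _ a b =>
    simp only [SimpleGraph.mem_edgeSet, SimpleGraph.map_adj, starK, completeBipartiteGraph_adj]
    constructor
    · rintro ⟨(u | u), (v | v), h, rfl, rfl⟩ <;> simp at h
      · exact ⟨v, by rw [Subsingleton.elim u 0]⟩
      · exact ⟨u, by rw [Subsingleton.elim v 0, Sym2.eq_swap]⟩
    · rintro ⟨i, hi⟩
      rcases Sym2.eq_iff.1 hi with ⟨rfl, rfl⟩ | ⟨rfl, rfl⟩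
      · exact ⟨Sum.inl 0, Sum.inr i, by simp, rfl, rfl⟩
      · exact ⟨Sum.inr i, Sum.inl 0, by simp, rfl, rfl⟩

/-- The edges of the complete graph at the vertex `v`. -/
def edgesAt {N : ℕ} (v : Fin N) : Set (⊤ : SimpleGraph (Fin N)).edgeSet :=
  {e | v ∈ (e : Sym2 (Fin N))}

theorem ncard_edgesAt_le {N : ℕ} (v : Fin N) : (edgesAt v).ncard ≤ N - 1 := by
  classical
  have h1 : ((↑) '' edgesAt v : Set (Sym2 (Fin N))) =
      ((⊤ : SimpleGraph (Fin N)).incidenceFinset v : Set (Sym2 (Fin N))) := by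
    ext e
    simp [edgesAt, SimpleGraph.incidenceSet]
    tauto
  rw [← Set.ncard_image_of_injective _ Subtype.val_injective, h1, Set.ncard_coe_finset,
    SimpleGraph.card_incidenceFinset_eq_degree, SimpleGraph.complete_graph_degree, Fintype.card_fin]

theorem exists_le_ncard_inter_edgesAt {m N : ℕ} {W : Set (⊤ : SimpleGraph (Fin N)).edgeSet}
    (hW : W ∈ copiesInComplete (starK m) N) : ∃ v, m ≤ (W ∩ edgesAt v).ncard := by
  obtain ⟨f, hf⟩ := hW
  let g : Fin m → (⊤ : SimpleGraph (Fin N)).edgeSet := fun i =>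
    ⟨s(f (Sum.inl 0), f (Sum.inr i)), by simp⟩
  have hg : Function.Injective g := fun i j hij => by
    have := congrArg Subtype.val hij
    simpa [g] using this
  refine ⟨f (Sum.inl 0), ?_⟩
  calc m = (Set.range g).ncard := by
        rw [← Set.image_univ, Set.ncard_image_of_injective _ hg, Set.ncard_univ, Nat.card_fin]
    _ ≤ _ := Set.ncard_le_ncard ?_
  rintro _ ⟨i, rfl⟩
  have hmem : (g i : Sym2 (Fin N)) ∈ Subtype.val '' W :=
    hf ▸ (mem_map_starK_edgeSet f _).2 ⟨i, rfl⟩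
  exact ⟨(Subtype.val_injective.mem_set_image).1 hmem, by simp [edgesAt, g]⟩

theorem hasWinningSet_of_star {m N : ℕ} {A : Set (⊤ : SimpleGraph (Fin N)).edgeSet} (v : Fin N)
    (T : Finset (Fin N)) (hT : m ≤ T.card)
    (hA : ∀ w ∈ T, ∃ e ∈ A, (e : Sym2 (Fin N)) = s(v, w)) :
    HasWinningSet (copiesInComplete (starK m) N) A := by
  have hv : ∀ w ∈ T, v ≠ w := by
    intro w hw
    obtain ⟨e, -, he⟩ := hA w hw
    have := e.2
    rw [he] at this
    simpa using this
  obtain ⟨g⟩ : Nonempty (Fin m ↪ T) :=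
    Function.Embedding.nonempty_of_card_le (by simpa using hT)
  let f : Fin 1 ⊕ Fin m ↪ Fin N :=
    ⟨Sum.elim (fun _ => v) (fun i => (g i : Fin N)), by
      rintro (a | a) (b | b) h
      · rw [Subsingleton.elim a b]
      · exact absurd h (hv _ (g b).2)
      · exact absurd h.symm (hv _ (g a).2)
      · exact congrArg Sum.inr (g.injective (Subtype.ext h))⟩
  refine ⟨Subtype.val ⁻¹' ((starK m).map f).edgeSet, ⟨f, ?_⟩, fun e he => ?_⟩
  · rw [Subtype.image_preimage_coe]
    exact Set.inter_eq_right.2 (SimpleGraph.edgeSet_mono le_top)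
  obtain ⟨i, hi⟩ := (mem_map_starK_edgeSet f _).1 he
  obtain ⟨e', he', h⟩ := hA (g i) (g i).2
  rwa [Subtype.ext (hi.trans h.symm)]

theorem aliceWinsAchievementGame_starK {m : ℕ} (hm : 0 < m) :
    AliceWinsAchievementGame (starK m) (2 * m) := by
  classical
  refine aliceHasWinningStrategy_of_no_draw ?_ ?_
  · rintro ⟨W, hW, hW0⟩
    obtain ⟨v, hv⟩ := exists_le_ncard_inter_edgesAt hW
    rw [Set.subset_empty_iff.1 hW0, Set.empty_inter, Set.ncard_empty] at hv
    omega
  · intro A B hAB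
    let v : Fin (2 * m) := ⟨0, by omega⟩
    let S (C : Set (⊤ : SimpleGraph (Fin (2 * m))).edgeSet) : Finset (Fin (2 * m)) :=
      {w | ∃ e ∈ C, (e : Sym2 (Fin (2 * m))) = s(v, w)}
    have hcov : Finset.univ.erase v ⊆ S A ∪ S B := by
      intro w hw
      have hw' : s(v, w) ∈ (⊤ : SimpleGraph (Fin (2 * m))).edgeSet := by
        simpa using (Finset.ne_of_mem_erase hw).symm
      have : (⟨s(v, w), hw'⟩ : (⊤ : SimpleGraph (Fin (2 * m))).edgeSet) ∈ A ∪ B :=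
        hAB ▸ Set.mem_univ _
      rcases this with h | h
      · exact Finset.mem_union_left _ (Finset.mem_filter.2 ⟨Finset.mem_univ _, _, h, rfl⟩)
      · exact Finset.mem_union_right _ (Finset.mem_filter.2 ⟨Finset.mem_univ _, _, h, rfl⟩)
    have hcard := (Finset.card_le_card hcov).trans (Finset.card_union_le _ _)
    rw [Finset.card_erase_of_mem (Finset.mem_univ _), Finset.card_univ, Fintype.card_fin] at hcard
    rcases (show m ≤ (S A).card ∨ m ≤ (S B).card by omega) with h | h
    · exact Or.inl (hasWinningSet_of_star v _ h fun w hw => (Finset.mem_filter.1 hw).2)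
    · exact Or.inr (hasWinningSet_of_star v _ h fun w hw => (Finset.mem_filter.1 hw).2)

/-- Winning is never vacuous: letting `σ` move for both players yields a complete play that follows
it. -/
theorem AliceHasWinningStrategy.nonempty {X : Type*} [Finite X] {F : Set (Set X)}
    (h : AliceHasWinningStrategy F) : F.Nonempty := by
  obtain ⟨σ, hσ⟩ := h
  obtain ⟨p, hp, hf⟩ := exists_isCompletePlay_of_strategy σ
  obtain ⟨u, -, ⟨W, hW, -⟩, -⟩ := hσ p hp fun u v x e _ hu => hf u v x e hu
  exact ⟨W, hW⟩

theorem le_of_aliceWinsAchievementGame_starK {m N : ℕ} (hm : 2 ≤ m)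
    (h : AliceWinsAchievementGame (starK m) N) :
    2 * (m : ℝ) - Real.sqrt ((4 * m - 4) * Real.log (4 * m)) ≤ N := by
  by_contra! hlt
  -- Excludes boards too small to hold the star, so that d = N - 1 is positive.
  obtain ⟨W, f, -⟩ := h.nonempty
  have hmN : 1 + m ≤ N := by simpa using Fintype.card_le_of_embedding f
  have hmR : (2 : ℝ) ≤ m := by exact_mod_cast hm
  have hlog : 0 < Real.log (4 * m) := Real.log_pos (by linarith)
  have hprod : 0 < (4 * (m : ℝ) - 4) * Real.log (4 * m) := mul_pos (by linarith) hlog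
  have hs : Real.sqrt ((4 * m - 4) * Real.log (4 * m)) < 2 * m - N := by linarith
  have hpos : (0 : ℝ) < 2 * m - N := (Real.sqrt_pos.2 hprod).trans hs
  have hsq : (4 * (m : ℝ) - 4) * Real.log (4 * m) < (2 * m - N) ^ 2 :=
    (Real.sqrt_lt' hpos).1 hs
  have hN2 : N + 1 ≤ 2 * m := by
    have : (N : ℝ) < (2 * m : ℕ) := by push_cast; linarith
    exact_mod_cast this
  have hN2R : (N : ℝ) + 1 ≤ 2 * m := by exact_mod_cast hN2
  have hcast : ((N - 1 : ℕ) : ℝ) = N - 1 := by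
    rw [Nat.cast_sub (by omega), Nat.cast_one]
  have hN1 : (0 : ℝ) < N - 1 := by
    have : (3 : ℝ) ≤ N := by exact_mod_cast (show 3 ≤ N by omega)
    linarith
  refine not_aliceHasWinningStrategy_of_discrepancy (F := copiesInComplete (starK m) N)
    (d := N - 1) (m := m) edgesAt (by omega) (by omega) ncard_edgesAt_le
    (fun W hW => exists_le_ncard_inter_edgesAt hW) ?_ h
  rw [hcast, Fintype.card_fin]
  have hexp : Real.log (4 * m) < (2 * m - (N - 1)) ^ 2 / (2 * ((N : ℝ) - 1)) := by
    rw [lt_div_iff₀ (by linarith)]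
    -- From N + 1 ≤ 2m; this is the source of the factor 4m - 4 in the bound.
    have h1 : Real.log (4 * m) * (2 * ((N : ℝ) - 1)) ≤ Real.log (4 * m) * (4 * m - 4) :=
      mul_le_mul_of_nonneg_left (by linarith) hlog.le
    nlinarith
  calc 2 * (N : ℝ) ≤ 4 * m := by linarith
    _ = Real.exp (Real.log (4 * m)) := (Real.exp_log (by linarith)).symm
    _ < _ := Real.exp_lt_exp.2 hexp

end Stars

/-- The first conjunct says that the achievement number is a genuine minimum. -/
theorem theorem2p4 (n : ℕ) (hn : 3 ≤ n) :
    (∃ N : ℕ, AliceWinsAchievementGame (starK (n - 1)) N) ∧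
    2 * (n : ℝ) - 2 - Real.sqrt ((4 * (n : ℝ) - 8) * Real.log (4 * (n : ℝ) - 4)) ≤
        (achievementNumber (starK (n - 1)) : ℝ) ∧
      (achievementNumber (starK (n - 1)) : ℝ) ≤ 2 * (n : ℝ) - 2 := by
  have hwin := aliceWinsAchievementGame_starK (m := n - 1) (by omega)
  have hcast : ((n - 1 : ℕ) : ℝ) = n - 1 := by rw [Nat.cast_sub (by omega), Nat.cast_one]
  refine ⟨⟨_, hwin⟩, ?_, ?_⟩
  -- Since a winning board exists, the infimum is attained and is not the default `sInf ∅ = 0`.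
  · have hmem : AliceWinsAchievementGame (starK (n - 1)) (achievementNumber (starK (n - 1))) :=
      Nat.sInf_mem (s := {N | AliceWinsAchievementGame (starK (n - 1)) N}) ⟨_, hwin⟩
    have := le_of_aliceWinsAchievementGame_starK (by omega) hmem
    rw [hcast] at this
    have e1 : 4 * ((n : ℝ) - 1) - 4 = 4 * n - 8 := by ring
    have e2 : 4 * ((n : ℝ) - 1) = 4 * n - 4 := by ring
    rw [e1, e2] at this
    linarith
  · have : achievementNumber (starK (n - 1)) ≤ 2 * (n - 1) := Nat.sInf_le hwin
    have h : (achievementNumber (starK (n - 1)) : ℝ) ≤ (2 * (n - 1) : ℕ) := by exact_mod_cast this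
    rw [Nat.cast_mul, hcast] at h
    push_cast at h
    linarith
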